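/- Let $A_\theta$ denote the quantum 2-torus with anticommuting unitary generators, i.e. the universal unital $C^*$-algebra generated by two unitaries $U_1, U_2$ subject to the relation $U_2U_1 = -U_1U_2$. Let $\alpha$ be the antipodal action of $\mathbb{Z}/2\mathbb{Z}$ on $C(\mathbb{S}^1)$, $\alpha(f)(z) = f(-z)$, and let $C(\mathbb{S}^1) \rtimes_\alpha \mathbb{Z}/2\mathbb{Z}$ be the crossed product, whose elements are written uniquely as $f + g\delta$ with $f, g \in C(\mathbb{S}^1)$, where $\delta$ is the self-adjoint unitary implementing the generator of $\mathbb{Z}/2\mathbb{Z}$, so that $\delta f = \alpha(f)\delta$. Let $\widehat{\alpha}$ be the dual action, $\widehat{\alpha}(f + g\delta) = f - g\delta$. Then there is an isomorphism of $C^*$-algebras $$A_\theta \cong \{h \in C(\mathbb{S}^1, C(\mathbb{S}^1) \rtimes_\alpha \mathbb{Z}/2\mathbb{Z}) : \widehat{\alpha}(h(-w)) = h(w) \text{ for all } w \in \mathbb{S}^1\}.$$ -/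

import Mathlib

open scoped ComplexConjugate

noncomputable section

/-! ### Crossed products by `ℤ/2ℤ` -/

/-- The crossed product `A ⋊_α ℤ/2ℤ` of a unital C⋆-algebra `A` by the action of `ℤ/2ℤ` generated
by a `⋆`-automorphism `α` with `α² = id`. Its elements are the formal sums `a₀ + a₁ δ` with
`a₀ a₁ : A`, where `δ` is the generator of `ℤ/2ℤ`: a self-adjoint unitary with `δ a = α(a) δ`. -/
@[ext]
structure CrossedProductZ2 {A : Type*} [CStarAlgebra A] (α : A ≃⋆ₐ[ℂ] A)
    (hα : ∀ a, α (α a) = a) where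
  /-- The coefficient of the identity of `ℤ/2ℤ`. -/
  a₀ : A
  /-- The coefficient of `δ`. -/
  a₁ : A

namespace CrossedProductZ2

variable {A : Type*} [CStarAlgebra A] {α : A ≃⋆ₐ[ℂ] A} {hα : ∀ a, α (α a) = a}

instance : Zero (CrossedProductZ2 α hα) := ⟨⟨0, 0⟩⟩
instance : One (CrossedProductZ2 α hα) := ⟨⟨1, 0⟩⟩
instance : Add (CrossedProductZ2 α hα) := ⟨fun x y => ⟨x.a₀ + y.a₀, x.a₁ + y.a₁⟩⟩
instance : Neg (CrossedProductZ2 α hα) := ⟨fun x => ⟨-x.a₀, -x.a₁⟩⟩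
instance : Sub (CrossedProductZ2 α hα) := ⟨fun x y => ⟨x.a₀ - y.a₀, x.a₁ - y.a₁⟩⟩

/-- `(a₀ + a₁ δ)(b₀ + b₁ δ) = (a₀ b₀ + a₁ α(b₁)) + (a₀ b₁ + a₁ α(b₀)) δ`. -/
instance : Mul (CrossedProductZ2 α hα) :=
  ⟨fun x y => ⟨x.a₀ * y.a₀ + x.a₁ * α y.a₁, x.a₀ * y.a₁ + x.a₁ * α y.a₀⟩⟩

/-- `(a₀ + a₁ δ)⋆ = a₀⋆ + α(a₁⋆) δ`. -/
instance : Star (CrossedProductZ2 α hα) := ⟨fun x => ⟨star x.a₀, α (star x.a₁)⟩⟩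

instance {R : Type*} [SMul R A] : SMul R (CrossedProductZ2 α hα) :=
  ⟨fun c x => ⟨c • x.a₀, c • x.a₁⟩⟩

@[simp] theorem zero_a₀ : (0 : CrossedProductZ2 α hα).a₀ = 0 := rfl
@[simp] theorem zero_a₁ : (0 : CrossedProductZ2 α hα).a₁ = 0 := rfl
@[simp] theorem one_a₀ : (1 : CrossedProductZ2 α hα).a₀ = 1 := rfl
@[simp] theorem one_a₁ : (1 : CrossedProductZ2 α hα).a₁ = 0 := rfl

section
variable (x y : CrossedProductZ2 α hα)

@[simp] theorem add_a₀ : (x + y).a₀ = x.a₀ + y.a₀ := rfl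
@[simp] theorem add_a₁ : (x + y).a₁ = x.a₁ + y.a₁ := rfl
@[simp] theorem neg_a₀ : (-x).a₀ = -x.a₀ := rfl
@[simp] theorem neg_a₁ : (-x).a₁ = -x.a₁ := rfl
@[simp] theorem sub_a₀ : (x - y).a₀ = x.a₀ - y.a₀ := rfl
@[simp] theorem sub_a₁ : (x - y).a₁ = x.a₁ - y.a₁ := rfl
@[simp] theorem mul_a₀ : (x * y).a₀ = x.a₀ * y.a₀ + x.a₁ * α y.a₁ := rfl
@[simp] theorem mul_a₁ : (x * y).a₁ = x.a₀ * y.a₁ + x.a₁ * α y.a₀ := rfl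
@[simp] theorem star_a₀ : (star x).a₀ = star x.a₀ := rfl
@[simp] theorem star_a₁ : (star x).a₁ = α (star x.a₁) := rfl
@[simp] theorem smul_a₀ {R : Type*} [SMul R A] (c : R) : (c • x).a₀ = c • x.a₀ := rfl
@[simp] theorem smul_a₁ {R : Type*} [SMul R A] (c : R) : (c • x).a₁ = c • x.a₁ := rfl

end

instance : AddCommGroup (CrossedProductZ2 α hα) where
  add_assoc x y z := by ext <;> simp [add_assoc]
  zero_add x := by ext <;> simp
  add_zero x := by ext <;> simp
  add_comm x y := by ext <;> simp [add_comm]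
  neg_add_cancel x := by ext <;> simp
  sub_eq_add_neg x y := by ext <;> simp [sub_eq_add_neg]
  nsmul := nsmulRec
  zsmul := zsmulRec

instance : Ring (CrossedProductZ2 α hα) where
  __ := (inferInstance : AddCommGroup (CrossedProductZ2 α hα))
  left_distrib x y z := by ext <;> simp [mul_add] <;> abel
  right_distrib x y z := by ext <;> simp [add_mul] <;> abel
  zero_mul x := by ext <;> simp
  mul_zero x := by ext <;> simp
  mul_assoc x y z := by ext <;> simp [mul_add, add_mul, mul_assoc, hα] <;> abel
  one_mul x := by ext <;> simp
  mul_one x := by ext <;> simp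

instance : Module ℂ (CrossedProductZ2 α hα) where
  one_smul x := by ext <;> simp
  mul_smul c d x := by ext <;> simp [mul_smul]
  smul_zero c := by ext <;> simp
  smul_add c x y := by ext <;> simp
  add_smul c d x := by ext <;> simp [add_smul]
  zero_smul x := by ext <;> simp

instance : Algebra ℂ (CrossedProductZ2 α hα) :=
  Algebra.ofModule (fun c x y => by ext <;> simp) (fun c x y => by ext <;> simp)

instance : StarRing (CrossedProductZ2 α hα) where
  star_involutive x := by ext <;> simp [← map_star, hα]
  star_mul x y := by ext <;> simp [← map_star, hα, add_comm]
  star_add x y := by ext <;> simp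

instance : StarModule ℂ (CrossedProductZ2 α hα) where
  star_smul c x := by ext <;> simp

/-- The regular representation `a₀ + a₁ δ ↦ !![a₀, a₁; α(a₁), α(a₀)]` on `A²`, from which the
C⋆-norm of the crossed product is obtained. (As `ℤ/2ℤ` is finite, the crossed product is complete
in this norm, which is thus its unique C⋆-norm.) -/
def toMatrix : CrossedProductZ2 α hα →⋆ₐ[ℂ] CStarMatrix (Fin 2) (Fin 2) A where
  toFun x := CStarMatrix.ofMatrix !![x.a₀, x.a₁; α x.a₁, α x.a₀]
  map_one' := by
    ext i j; fin_cases i <;> fin_cases j <;> simp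
  map_mul' x y := by
    ext i j
    fin_cases i <;> fin_cases j <;>
      simp [CStarMatrix.mul_apply, hα, add_comm]
  map_zero' := by
    ext i j; fin_cases i <;> fin_cases j <;> simp
  map_add' x y := by
    ext i j; fin_cases i <;> fin_cases j <;> simp
  commutes' c := by
    ext i j
    fin_cases i <;> fin_cases j <;>
      simp [Algebra.algebraMap_eq_smul_one]
  map_star' x := by
    ext i j
    fin_cases i <;> fin_cases j <;>
      simp [CStarMatrix.star_apply, hα, ← map_star]

theorem toMatrix_injective : Function.Injective (toMatrix : CrossedProductZ2 α hα → _) := by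
  intro x y h
  ext
  · simpa [toMatrix] using congrFun (congrFun h 0) 0
  · simpa [toMatrix] using congrFun (congrFun h 0) 1

section norm

attribute [local instance] CStarAlgebra.spectralOrder CStarAlgebra.spectralOrderedRing

/-- The C⋆-norm of the crossed product: the operator norm in the regular representation. -/
instance : NormedRing (CrossedProductZ2 α hα) :=
  NormedRing.induced _ (CStarMatrix (Fin 2) (Fin 2) A) (toMatrix (α := α) (hα := hα))
    toMatrix_injective

theorem norm_def (x : CrossedProductZ2 α hα) : ‖x‖ = ‖toMatrix x‖ := rfl

theorem isometry_toMatrix : Isometry (toMatrix : CrossedProductZ2 α hα → _) :=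
  AddMonoidHomClass.isometry_of_norm _ fun _ => rfl

theorem isClosed_range_toMatrix : IsClosed (Set.range (toMatrix : CrossedProductZ2 α hα → _)) := by
  have hc : Continuous α := (NonUnitalStarAlgHom.isometry (α : A →⋆ₐ[ℂ] A) α.injective).continuous
  have hr : Set.range (toMatrix : CrossedProductZ2 α hα → _) =
      {M | M 1 0 = α (M 0 1) ∧ M 1 1 = α (M 0 0)} := by
    ext M
    constructor
    · rintro ⟨x, rfl⟩
      simp [toMatrix]
    · rintro ⟨h₁, h₂⟩
      refine ⟨⟨M 0 0, M 0 1⟩, ?_⟩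
      ext i j
      fin_cases i <;> fin_cases j <;> simp [toMatrix, h₁, h₂]
  have he (i j : Fin 2) : Continuous fun M : CStarMatrix (Fin 2) (Fin 2) A => M i j :=
    (continuous_apply j).comp (continuous_apply i)
  rw [hr]
  exact (isClosed_eq (he 1 0) (hc.comp (he 0 1))).inter (isClosed_eq (he 1 1) (hc.comp (he 0 0)))

instance : CStarAlgebra (CrossedProductZ2 α hα) where
  complete := by
    have h : CompleteSpace (CrossedProductZ2 α hα) :=
      (completeSpace_iff_isComplete_range isometry_toMatrix.isUniformInducing).2
        isClosed_range_toMatrix.isComplete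
    exact fun {f} hf => h.complete hf
  norm_mul_self_le x := by
    rw [norm_def, norm_def, map_mul, map_star, CStarRing.norm_star_mul_self]
  norm_smul_le c x := by
    rw [norm_def, norm_def, map_smul]
    exact norm_smul_le c _

end norm

/-- The dual action `α̂ (a₀ + a₁ δ) = a₀ - a₁ δ` on the crossed product. -/
def dualAction : CrossedProductZ2 α hα ≃⋆ₐ[ℂ] CrossedProductZ2 α hα where
  toFun x := ⟨x.a₀, -x.a₁⟩
  invFun x := ⟨x.a₀, -x.a₁⟩
  left_inv x := by ext <;> simp
  right_inv x := by ext <;> simp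
  map_mul' x y := by ext <;> simp [add_comm]
  map_add' x y := by ext <;> simp [add_comm]
  map_star' x := by ext <;> simp
  map_smul' c x := by ext <;> simp

end CrossedProductZ2

/-! ### The antipodal action on the circle and the algebra of symmetric functions -/

/-- The antipodal action on `C(S¹)`: `(α f)(z) = f(-z)`. -/
def antipodal : C(Circle, ℂ) ≃⋆ₐ[ℂ] C(Circle, ℂ) where
  toFun f := f.comp ⟨fun z => -z, continuous_neg⟩
  invFun f := f.comp ⟨fun z => -z, continuous_neg⟩
  left_inv f := by ext z; simp
  right_inv f := by ext z; simp
  map_mul' f g := rfl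
  map_add' f g := rfl
  map_star' f := rfl
  map_smul' c f := rfl

theorem antipodal_antipodal (f : C(Circle, ℂ)) : antipodal (antipodal f) = f :=
  antipodal.left_inv f

/-- The crossed product `C(S¹) ⋊_α ℤ/2ℤ` by the antipodal action `α`. -/
abbrev CircleCrossedProduct : Type := CrossedProductZ2 antipodal antipodal_antipodal

/-- The `⋆`-subalgebra of `C(S¹, C(S¹) ⋊_α ℤ/2ℤ)` of all `h` with `α̂ (h (-w)) = h w` for all
`w ∈ S¹`. -/
def symmetricFunctions : StarSubalgebra ℂ C(Circle, CircleCrossedProduct) where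
  carrier := {h | ∀ w, CrossedProductZ2.dualAction (h (-w)) = h w}
  mul_mem' {f g} hf hg w := by simp [hf w, hg w]
  one_mem' w := by simp
  add_mem' {f g} hf hg w := by simp [hf w, hg w]
  zero_mem' w := by simp
  algebraMap_mem' c w := by simp [Algebra.algebraMap_eq_smul_one]
  star_mem' {f} hf w := by simp [map_star, hf w]

/-! ### C⋆-seminorms and quantum tori -/

/-- A C⋆-seminorm on a unital complex `⋆`-algebra. -/
structure CStarSeminorm (F : Type*) [Ring F] [StarRing F] [Algebra ℂ F] extends
    Seminorm ℂ F where
  mul_le' : ∀ x y, toFun (x * y) ≤ toFun x * toFun y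
  star_mul_self' : ∀ x, toFun (star x * x) = toFun x ^ 2

/-- The free unital `⋆`-algebra generated by two unitaries: the group algebra of the free group
on two letters (its elements are the noncommutative `⋆`-polynomials in `U₁`, `U₂`, reduced
by `Uⱼ⋆ Uⱼ = Uⱼ Uⱼ⋆ = 1`). The parameter `ρ` only determines the seminorm put on it below. -/
def PreTorus (_ρ : Circle) : Type := MonoidAlgebra ℂ (FreeGroup (Fin 2))

namespace PreTorus

variable {ρ : Circle}

instance : Ring (PreTorus ρ) := inferInstanceAs (Ring (MonoidAlgebra ℂ (FreeGroup (Fin 2))))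

instance : Algebra ℂ (PreTorus ρ) :=
  inferInstanceAs (Algebra ℂ (MonoidAlgebra ℂ (FreeGroup (Fin 2))))

/-- The element `c • g`, for `g` a reduced word in `U₁`, `U₂` and their inverses. -/
def single (g : FreeGroup (Fin 2)) (c : ℂ) : PreTorus ρ := MonoidAlgebra.single g c

theorem single_mul_single (g h : FreeGroup (Fin 2)) (c d : ℂ) :
    (single g c * single h d : PreTorus ρ) = single (g * h) (c * d) :=
  MonoidAlgebra.single_mul_single ..

theorem smul_single (g : FreeGroup (Fin 2)) (c d : ℂ) :
    (c • single g d : PreTorus ρ) = single g (c * d) :=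
  MonoidAlgebra.smul_single ..

theorem induction {P : PreTorus ρ → Prop} (x : PreTorus ρ) (h0 : P 0)
    (hadd : ∀ x y, P x → P y → P (x + y)) (hs : ∀ g c, P (single g c)) : P x :=
  MonoidAlgebra.induction_linear x h0 hadd hs

/-- The conjugate-linear map with `g ↦ g⁻¹` for every word `g`. -/
def starHom : PreTorus ρ →+ PreTorus ρ :=
  show MonoidAlgebra ℂ (FreeGroup (Fin 2)) →+ MonoidAlgebra ℂ (FreeGroup (Fin 2)) from
  { toFun := fun x => MonoidAlgebra.map (starRingEnd ℂ).toAddMonoidHom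
      (MonoidAlgebra.mapDomain (fun g => g⁻¹) x)
    map_zero' := by rw [MonoidAlgebra.mapDomain_zero, MonoidAlgebra.map_zero]
    map_add' := fun x y => by rw [MonoidAlgebra.mapDomain_add, MonoidAlgebra.map_add] }

theorem starHom_single (g : FreeGroup (Fin 2)) (c : ℂ) :
    starHom (single g c : PreTorus ρ) = single g⁻¹ (conj c) := by
  change MonoidAlgebra.map _ (MonoidAlgebra.mapDomain _ (MonoidAlgebra.single g c)) = _
  rw [MonoidAlgebra.mapDomain_single, MonoidAlgebra.map_single]
  rfl

/-- The involution: conjugate-linear, with `g⋆ = g⁻¹` for every word `g`. -/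
instance : Star (PreTorus ρ) := ⟨starHom⟩

theorem star_single (g : FreeGroup (Fin 2)) (c : ℂ) :
    star (single g c : PreTorus ρ) = single g⁻¹ (conj c) := starHom_single g c

theorem star_zero' : star (0 : PreTorus ρ) = 0 := map_zero starHom

theorem star_add' (x y : PreTorus ρ) : star (x + y) = star x + star y := map_add starHom x y

instance : StarRing (PreTorus ρ) where
  star_involutive x := by
    induction x using induction with
    | h0 => simp [star_zero']
    | hadd x y hx hy => rw [star_add', star_add', hx, hy]
    | hs g c => simp [star_single]
  star_mul x y := by
    induction x using induction with
    | h0 => simp [star_zero']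
    | hadd x y hx hy => rw [add_mul, star_add', star_add', hx, hy, mul_add]
    | hs g c =>
      induction y using induction with
      | h0 => simp [star_zero']
      | hadd x y hx hy => rw [mul_add, star_add', star_add', hx, hy, add_mul]
      | hs h d => simp [star_single, single_mul_single, mul_comm]
  star_add := star_add'

instance : StarModule ℂ (PreTorus ρ) where
  star_smul c x := by
    induction x using induction with
    | h0 => simp
    | hadd x y hx hy => rw [smul_add, star_add, star_add, hx, hy, smul_add]
    | hs g d => simp [star_single, smul_single]

/-- The unitary generators `U₁ = gen 0` and `U₂ = gen 1`. -/
def gen (j : Fin 2) : PreTorus ρ := single (FreeGroup.of j) 1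

/-- The C⋆-seminorms in which the relation `U₂ U₁ = ρ U₁ U₂` holds. -/
def AdmissibleSeminorm (ρ : Circle) : Type :=
  {p : CStarSeminorm (PreTorus ρ) //
    p.toFun (gen 1 * gen 0 - (ρ : ℂ) • (gen 0 * gen 1)) = 0}

namespace AdmissibleSeminorm

instance : Inhabited (AdmissibleSeminorm ρ) :=
  ⟨⟨{ (0 : Seminorm ℂ (PreTorus ρ)) with
      mul_le' := fun _ _ => (zero_mul (0 : ℝ)).ge
      star_mul_self' := fun _ => (zero_pow two_ne_zero).symm }, rfl⟩⟩

/-- The underlying seminorm. -/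
def toSeminorm (p : AdmissibleSeminorm ρ) : Seminorm ℂ (PreTorus ρ) := p.1.toSeminorm

theorem mul_le (p : AdmissibleSeminorm ρ) (x y : PreTorus ρ) :
    p.toSeminorm (x * y) ≤ p.toSeminorm x * p.toSeminorm y := p.1.mul_le' x y

theorem star_mul_self (p : AdmissibleSeminorm ρ) (x : PreTorus ρ) :
    p.toSeminorm (star x * x) = p.toSeminorm x ^ 2 := p.1.star_mul_self' x

theorem single_le (p : AdmissibleSeminorm ρ) (g : FreeGroup (Fin 2)) (c : ℂ) :
    p.toSeminorm (single g c) ≤ ‖c‖ := by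
  have h1 : p.toSeminorm (single 1 1) ≤ 1 := by
    have h := p.star_mul_self (single 1 1)
    simp only [star_single, single_mul_single, inv_one, mul_one, map_one] at h
    nlinarith [apply_nonneg p.toSeminorm (single 1 1)]
  have hg : p.toSeminorm (single g 1) ≤ 1 := by
    have h := p.star_mul_self (single g 1)
    simp only [star_single, single_mul_single, inv_mul_cancel, mul_one, map_one] at h
    nlinarith [apply_nonneg p.toSeminorm (single g 1)]
  have h := map_smul_eq_mul p.toSeminorm c (single g 1)
  rw [smul_single, mul_one] at h
  rw [h]
  exact mul_le_of_le_one_right (norm_nonneg c) hg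

theorem bddAbove (x : PreTorus ρ) :
    BddAbove (Set.range fun p : AdmissibleSeminorm ρ => p.toSeminorm x) := by
  induction x using induction with
  | h0 => exact ⟨0, by rintro _ ⟨p, rfl⟩; simp⟩
  | hadd x y hx hy =>
    obtain ⟨a, ha⟩ := hx
    obtain ⟨b, hb⟩ := hy
    refine ⟨a + b, ?_⟩
    rintro _ ⟨p, rfl⟩
    exact (map_add_le_add p.toSeminorm x y).trans (add_le_add (ha ⟨p, rfl⟩) (hb ⟨p, rfl⟩))
  | hs g c => exact ⟨‖c‖, by rintro _ ⟨p, rfl⟩; exact p.single_le g c⟩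

theorem star_le (p : AdmissibleSeminorm ρ) (x : PreTorus ρ) :
    p.toSeminorm x ≤ p.toSeminorm (star x) := by
  have h₁ := p.star_mul_self x
  have h₂ := p.mul_le (star x) x
  rcases (apply_nonneg p.toSeminorm x).eq_or_lt with h | h
  · rw [← h]
    exact apply_nonneg _ _
  · nlinarith

end AdmissibleSeminorm

/-- The universal C⋆-seminorm: the supremum of all C⋆-seminorms in which the defining relation
holds (a finite supremum, since words have seminorm at most `1`). -/
instance : Norm (PreTorus ρ) := ⟨fun x => ⨆ p : AdmissibleSeminorm ρ, p.toSeminorm x⟩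

theorem le_norm (p : AdmissibleSeminorm ρ) (x : PreTorus ρ) : p.toSeminorm x ≤ ‖x‖ :=
  le_ciSup (AdmissibleSeminorm.bddAbove x) p

theorem norm_le {x : PreTorus ρ} {a : ℝ} (h : ∀ p : AdmissibleSeminorm ρ, p.toSeminorm x ≤ a) :
    ‖x‖ ≤ a :=
  ciSup_le h

theorem norm_nonneg' (x : PreTorus ρ) : 0 ≤ ‖x‖ :=
  (apply_nonneg (default : AdmissibleSeminorm ρ).toSeminorm x).trans (le_norm _ x)

instance : SeminormedRing (PreTorus ρ) where
  __ := SeminormedAddCommGroup.ofCore (𝕜 := ℂ) (E := PreTorus ρ)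
    { norm_nonneg := norm_nonneg'
      norm_smul := fun c x => by
        have h : ∀ (c : ℂ) (x : PreTorus ρ), ‖c • x‖ ≤ ‖c‖ * ‖x‖ := fun c x =>
          norm_le fun p => by
            rw [map_smul_eq_mul]
            exact mul_le_mul_of_nonneg_left (le_norm p x) (norm_nonneg c)
        refine le_antisymm (h c x) ?_
        rcases eq_or_ne c 0 with rfl | hc
        · simpa using norm_nonneg' _
        · have h' := h c⁻¹ (c • x)
          rw [inv_smul_smul₀ hc, norm_inv] at h'
          rwa [← le_inv_mul_iff₀ (norm_pos_iff.2 hc)]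
      norm_triangle := fun x y => norm_le fun p =>
        (map_add_le_add p.toSeminorm x y).trans (add_le_add (le_norm p x) (le_norm p y)) }
  __ := (inferInstance : Ring (PreTorus ρ))
  norm_mul_le x y := norm_le fun p => (p.mul_le x y).trans
    (mul_le_mul (le_norm p x) (le_norm p y) (apply_nonneg _ _) (norm_nonneg' x))

instance : NormedSpace ℂ (PreTorus ρ) where
  norm_smul_le c x := norm_le fun p => by
    rw [map_smul_eq_mul]
    exact mul_le_mul_of_nonneg_left (le_norm p x) (norm_nonneg c)

theorem norm_le_norm_star (x : PreTorus ρ) : ‖x‖ ≤ ‖star x‖ :=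
  norm_le fun p => (p.star_le x).trans (le_norm p _)

instance : NormedStarGroup (PreTorus ρ) where
  norm_star_le x := by simpa using norm_le_norm_star (star x)

theorem norm_mul_self_le (x : PreTorus ρ) : ‖x‖ * ‖x‖ ≤ ‖star x * x‖ := by
  have h : ‖x‖ ≤ √‖star x * x‖ := norm_le fun p =>
    Real.le_sqrt_of_sq_le ((p.star_mul_self x).symm.le.trans (le_norm p _))
  rw [← sq]
  exact (Real.le_sqrt (norm_nonneg _) (norm_nonneg _)).1 h

end PreTorus

/-- The quantum 2-torus `A_θ`, `ρ = exp (2π i θ)`: the universal unital C⋆-algebra generated by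
two unitaries `U₁`, `U₂` subject to `U₂ U₁ = ρ U₁ U₂`, that is, the Hausdorff completion of the
`⋆`-algebra of noncommutative `⋆`-polynomials in `U₁`, `U₂` in its universal C⋆-seminorm. -/
abbrev QuantumTorus (ρ : Circle) : Type := UniformSpace.Completion (PreTorus ρ)

namespace QuantumTorus

variable {ρ : Circle}

/-- The involution is the continuous extension of that on `⋆`-polynomials. -/
instance : Star (QuantumTorus ρ) := ⟨UniformSpace.Completion.map star⟩

theorem star_coe (x : PreTorus ρ) : star (x : QuantumTorus ρ) = (star x : PreTorus ρ) :=
  UniformSpace.Completion.map_coe star_isometry.uniformContinuous x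

theorem continuous_star' : Continuous (star : QuantumTorus ρ → QuantumTorus ρ) :=
  UniformSpace.Completion.continuous_map

instance : StarRing (QuantumTorus ρ) where
  star_involutive x := by
    induction x using UniformSpace.Completion.induction_on with
    | hp => exact isClosed_eq (continuous_star'.comp continuous_star') continuous_id
    | ih x => rw [star_coe, star_coe, star_star]
  star_mul x y := by
    induction x, y using UniformSpace.Completion.induction_on₂ with
    | hp =>
      exact isClosed_eq (continuous_star'.comp (continuous_fst.mul continuous_snd))
        ((continuous_star'.comp continuous_snd).mul (continuous_star'.comp continuous_fst))
    | ih x y =>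
      rw [← UniformSpace.Completion.coe_mul, star_coe, star_coe, star_coe, star_mul,
        UniformSpace.Completion.coe_mul]
  star_add x y := by
    induction x, y using UniformSpace.Completion.induction_on₂ with
    | hp =>
      exact isClosed_eq (continuous_star'.comp (continuous_fst.add continuous_snd))
        ((continuous_star'.comp continuous_fst).add (continuous_star'.comp continuous_snd))
    | ih x y =>
      rw [← UniformSpace.Completion.coe_add, star_coe, star_coe, star_coe, star_add,
        UniformSpace.Completion.coe_add]

instance : CStarAlgebra (QuantumTorus ρ) where
  norm_smul_le c x := norm_smul_le c x
  norm_mul_self_le x := by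
    induction x using UniformSpace.Completion.induction_on with
    | hp =>
      exact isClosed_le (continuous_norm.mul continuous_norm)
        (continuous_norm.comp (continuous_star'.mul continuous_id))
    | ih x =>
      rw [star_coe, ← UniformSpace.Completion.coe_mul, UniformSpace.Completion.norm_coe,
        UniformSpace.Completion.norm_coe]
      exact PreTorus.norm_mul_self_le x
  star_smul c x := by
    induction x using UniformSpace.Completion.induction_on with
    | hp =>
      exact isClosed_eq (continuous_star'.comp (continuous_const_smul c))
        ((continuous_const_smul (star c)).comp continuous_star')
    | ih x =>
      rw [← UniformSpace.Completion.coe_smul, star_coe, star_coe, star_smul,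
        UniformSpace.Completion.coe_smul]

end QuantumTorus

end

/-! Both algebras are universal for a pair of unitaries `u`, `v` with `v u = -u v`, so each maps to
the other with generators going to generators, and the two maps are mutually inverse.

For the quantum torus this is built into the universal seminorm. On the other side the generators
are the constant function `z` (`coordinate`) and `V : w ↦ w δ` (`rotatedDelta`). The symmetry
condition says that the coefficient of `1` is even in `w` and the coefficient of `δ` is odd. Even
functions of `w` are functions of `w²`, so every symmetric function is uniquely `F(z, w²) + G(z, w²)
V` with `F, G ∈ C(𝕋²)` (`exists_eq_ofTorus_add_mul`, `ofTorus_add_mul_injective`). Products are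
governed by `V² = w²` and `V F(z, ·) = F(-z, ·) V`.

Given anticommuting unitaries `u`, `v` in `A`, the unitaries `u` and `v²` commute, and Gelfand
duality yields `Φ : C(𝕋²) → A` with values `u`, `v²` on the coordinates. Conjugation by `v` acts on
the image of `Φ` as `z ↦ -z`, so `F + G V ↦ Φ(F) + Φ(G) v` is a `⋆`-homomorphism
(`symmetricFunctions.exists_lift`). -/

open scoped CStarAlgebra

/-! ### Commuting unitaries and `C(𝕋²)` -/

namespace ContinuousMap

/-- The inclusion `Circle → ℂ` of the first factor of the torus. -/
def torusFst : C(Circle × Circle, ℂ) := ⟨fun p => p.1, by fun_prop⟩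

/-- The inclusion `Circle → ℂ` of the second factor of the torus. -/
def torusSnd : C(Circle × Circle, ℂ) := ⟨fun p => p.2, by fun_prop⟩

@[simp] theorem torusFst_apply (p : Circle × Circle) : torusFst p = p.1 := rfl
@[simp] theorem torusSnd_apply (p : Circle × Circle) : torusSnd p = p.2 := rfl

/-- Stone–Weierstrass: the two coordinates separate the points of the torus. -/
theorem adjoin_torus_topologicalClosure :
    (StarAlgebra.adjoin ℂ {torusFst, torusSnd}).topologicalClosure = ⊤ := by
  apply starSubalgebra_topologicalClosure_eq_top_of_separatesPoints
  intro p q hpq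
  by_cases h : p.1 = q.1
  · refine ⟨torusSnd, ⟨torusSnd, StarAlgebra.subset_adjoin ℂ _ (by simp), rfl⟩, fun h' => hpq ?_⟩
    exact Prod.ext h (Circle.ext h')
  · exact ⟨torusFst, ⟨torusFst, StarAlgebra.subset_adjoin ℂ _ (by simp), rfl⟩,
      fun h' => h (Circle.ext h')⟩

/-- A `⋆`-homomorphism on `C(𝕋²)` is determined by the images of the coordinate functions. -/
theorem starAlgHom_torus_ext {A : Type*} [CStarAlgebra A]
    {f g : C(Circle × Circle, ℂ) →⋆ₐ[ℂ] A} (h₁ : f torusFst = g torusFst)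
    (h₂ : f torusSnd = g torusSnd) : f = g := by
  have hle : StarAlgebra.adjoin ℂ {torusFst, torusSnd} ≤ StarAlgHom.equalizer f g := by
    refine StarAlgebra.adjoin_le ?_
    rintro _ (rfl | rfl)
    exacts [h₁, h₂]
  have hcl : IsClosed (StarAlgHom.equalizer f g : Set C(Circle × Circle, ℂ)) :=
    isClosed_eq (map_continuous f) (map_continuous g)
  have := StarSubalgebra.topologicalClosure_minimal hle hcl
  rw [adjoin_torus_topologicalClosure] at this
  ext1 x
  exact this (StarSubalgebra.mem_top (x := x))

end ContinuousMap

/-- Two commuting unitaries in a commutative C⋆-algebra define a `⋆`-homomorphism on `C(𝕋²)`. -/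
theorem CommCStarAlgebra.exists_torus_starAlgHom {A : Type*} [CommCStarAlgebra A]
    (u v : unitary A) : ∃ Φ : C(Circle × Circle, ℂ) →⋆ₐ[ℂ] A,
      Φ ContinuousMap.torusFst = u ∧ Φ ContinuousMap.torusSnd = v := by
  have hmem (a : unitary A) (χ : WeakDual.characterSpace ℂ A) :
      gelfandStarTransform A a χ ∈ Submonoid.unitSphere ℂ := by
    have h : gelfandStarTransform A a χ * star (gelfandStarTransform A a χ) = 1 := by
      rw [← ContinuousMap.star_apply, ← map_star, ← ContinuousMap.mul_apply, ← map_mul]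
      simp
    have h' := congrArg norm h
    rw [norm_mul, norm_star, norm_one] at h'
    refine mem_sphere_zero_iff_norm.2 ?_
    nlinarith [norm_nonneg (gelfandStarTransform A a χ)]
  -- Gelfand transforms of unitaries have modulus one, so `u` and `v` together map the character
  -- space to the torus. Pulling back along this map and inverting the Gelfand transform gives `Φ`.
  let e : C(WeakDual.characterSpace ℂ A, Circle × Circle) :=
    ⟨fun χ => (⟨gelfandStarTransform A u χ, hmem u χ⟩, ⟨gelfandStarTransform A v χ, hmem v χ⟩),
      by
        refine Continuous.prodMk ?_ ?_ <;> refine Continuous.subtype_mk ?_ _ <;>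
          exact map_continuous _⟩
  refine ⟨((gelfandStarTransform A).symm : _ →⋆ₐ[ℂ] A).comp
    (ContinuousMap.compStarAlgHom' ℂ ℂ e), ?_, ?_⟩
  · exact (gelfandStarTransform A).symm_apply_apply u
  · exact (gelfandStarTransform A).symm_apply_apply v

/-- Two commuting unitaries in a C⋆-algebra define a `⋆`-homomorphism on `C(𝕋²)`. -/
theorem CStarAlgebra.exists_torus_starAlgHom {A : Type*} [CStarAlgebra A]
    (u v : unitary A) (h : Commute u v) : ∃ Φ : C(Circle × Circle, ℂ) →⋆ₐ[ℂ] A,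
      Φ ContinuousMap.torusFst = u ∧ Φ ContinuousMap.torusSnd = v := by
  let S : StarSubalgebra ℂ A := StarAlgebra.adjoin ℂ {(u : A), (v : A)}
  have hc (a b : unitary A) (ha : a = u ∨ a = v) (hb : b = u ∨ b = v) : Commute a b := by
    rcases ha with rfl | rfl <;> rcases hb with rfl | rfl
    exacts [Commute.refl _, h, h.symm, Commute.refl _]
  have hsub : ∀ a ∈ ({(u : A), (v : A)} : Set A), ∃ a' : unitary A, (a' = u ∨ a' = v) ∧ a = a' := by
    rintro _ (rfl | rfl)
    exacts [⟨u, .inl rfl, rfl⟩, ⟨v, .inr rfl, rfl⟩]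
  have hS : ∀ x y : S, x * y = y * x := by
    have : IsMulCommutative S := StarAlgebra.isMulCommutative_adjoin ℂ
      (fun a ha b hb => by
        obtain ⟨a, ha', rfl⟩ := hsub a ha
        obtain ⟨b, hb', rfl⟩ := hsub b hb
        exact congrArg Subtype.val (hc a b ha' hb').eq)
      -- Commutation with adjoints is also required; for unitaries the adjoint is the inverse.
      (fun a ha b hb => by
        obtain ⟨a, ha', rfl⟩ := hsub a ha
        obtain ⟨b, hb', rfl⟩ := hsub b hb
        exact congrArg Subtype.val (hc a b ha' hb').inv_right.eq)
    exact fun x y => this.is_comm.comm x y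
  have hcl : IsClosed (S.topologicalClosure : Set A) := S.isClosed_topologicalClosure
  let _ : CStarAlgebra S.topologicalClosure := StarSubalgebra.cstarAlgebra _ (h_closed := hcl)
  let _ : CommCStarAlgebra S.topologicalClosure :=
    { (inferInstance : CStarAlgebra S.topologicalClosure) with
      mul_comm := (S.commRingTopologicalClosure hS).mul_comm }
  have hu : (u : A) ∈ S.topologicalClosure :=
    S.le_topologicalClosure (StarAlgebra.subset_adjoin ℂ _ (by simp))
  have hv : (v : A) ∈ S.topologicalClosure :=
    S.le_topologicalClosure (StarAlgebra.subset_adjoin ℂ _ (by simp))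
  obtain ⟨Φ, h₁, h₂⟩ := CommCStarAlgebra.exists_torus_starAlgHom
    (⟨⟨u, hu⟩, by constructor <;> ext <;> simp⟩ : unitary S.topologicalClosure)
    ⟨⟨v, hv⟩, by constructor <;> ext <;> simp⟩
  refine ⟨S.topologicalClosure.subtype.comp Φ, ?_, ?_⟩
  · simp [h₁]
  · simp [h₂]

/-! ### Universal property of the quantum torus -/

namespace PreTorus

variable {ρ : Circle}

theorem single_eq_smul (g : FreeGroup (Fin 2)) (c : ℂ) :
    (single g c : PreTorus ρ) = c • single g 1 := by
  rw [smul_single, mul_one]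

theorem star_gen_mul_gen (j : Fin 2) : star (gen j : PreTorus ρ) * gen j = 1 := by
  rw [gen, star_single, single_mul_single, inv_mul_cancel, map_one, one_mul]
  rfl

theorem gen_mul_star_gen (j : Fin 2) : (gen j : PreTorus ρ) * star (gen j) = 1 := by
  rw [gen, star_single, single_mul_single, mul_inv_cancel, map_one, one_mul]
  rfl

/-- Every admissible seminorm kills the relation, hence so does their supremum. -/
theorem norm_relation : ‖(gen 1 * gen 0 - (ρ : ℂ) • (gen 0 * gen 1) : PreTorus ρ)‖ = 0 :=
  le_antisymm (norm_le fun p => p.2.le) (norm_nonneg' _)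

/-- The `⋆`-homomorphism on `⋆`-polynomials given by evaluation at two unitaries. -/
theorem exists_lift {B : Type*} [CStarAlgebra B] (u : Fin 2 → unitary B) :
    ∃ π : PreTorus ρ →⋆ₐ[ℂ] B, ∀ j, π (gen j) = u j := by
  let φ : PreTorus ρ →ₐ[ℂ] B :=
    MonoidAlgebra.lift ℂ B (FreeGroup (Fin 2)) ((unitary B).subtype.comp (FreeGroup.lift u))
  have hφ (g : FreeGroup (Fin 2)) (c : ℂ) :
      φ (single g c) = c • (FreeGroup.lift u g : B) := MonoidAlgebra.lift_single _ _ _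
  refine ⟨{ φ with map_star' := fun x => ?_ }, fun j => ?_⟩
  · change φ (star x) = star (φ x)
    induction x using induction with
    | h0 => simp
    | hadd x y hx hy => rw [star_add, map_add, hx, hy, map_add, star_add]
    | hs g c => rw [star_single, hφ, hφ, map_inv, star_smul]; rfl
  · change φ (single _ 1) = _
    rw [hφ, FreeGroup.lift_apply_of, one_smul]

end PreTorus

namespace QuantumTorus

open PreTorus UniformSpace.Completion

variable {ρ : Circle}

/-- The unitary generators of the quantum torus. -/
noncomputable def gen (j : Fin 2) : QuantumTorus ρ := (PreTorus.gen j : PreTorus ρ)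

theorem coe_gen (j : Fin 2) : ((PreTorus.gen j : PreTorus ρ) : QuantumTorus ρ) = gen j := rfl

theorem gen_mem_unitary (j : Fin 2) : (gen j : QuantumTorus ρ) ∈ unitary (QuantumTorus ρ) := by
  constructor
  · rw [← coe_gen, star_coe, ← coe_mul, star_gen_mul_gen, coe_one]
  · rw [← coe_gen, star_coe, ← coe_mul, gen_mul_star_gen, coe_one]

theorem gen_mul_gen :
    (gen 1 * gen 0 : QuantumTorus ρ) = (ρ : ℂ) • (gen 0 * gen 1 : QuantumTorus ρ) := by
  rw [← sub_eq_zero, ← norm_eq_zero, ← coe_gen, ← coe_gen, ← coe_mul, ← coe_mul, ← coe_smul, ← coe_sub,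
    norm_coe, norm_relation]

/-- The universal property of the quantum torus: existence. -/
theorem exists_lift {B : Type*} [CStarAlgebra B] (u : Fin 2 → unitary B)
    (h : (u 1 * u 0 : B) = (ρ : ℂ) • (u 0 * u 1 : B)) :
    ∃ π : QuantumTorus ρ →⋆ₐ[ℂ] B, ∀ j, π (gen j) = u j := by
  obtain ⟨π, hπ⟩ := PreTorus.exists_lift (ρ := ρ) u
  -- The norm of `B` pulled back along `π` is admissible because `u` satisfies the relation. The
  -- universal norm dominates it, so `π` is contractive and extends to the completion.
  let p : AdmissibleSeminorm ρ :=
    ⟨{ (normSeminorm ℂ B).comp (π : PreTorus ρ →ₐ[ℂ] B).toLinearMap with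
        mul_le' := fun x y => by
          change ‖π (x * y)‖ ≤ ‖π x‖ * ‖π y‖
          rw [map_mul]
          exact norm_mul_le _ _
        star_mul_self' := fun x => by
          change ‖π (star x * x)‖ = ‖π x‖ ^ 2
          rw [map_mul, map_star, CStarRing.norm_star_mul_self, sq] }, by
      change ‖π _‖ = 0
      rw [map_sub, map_smul, map_mul, map_mul, hπ, hπ, h, sub_self, norm_zero]⟩
  have hle (x : PreTorus ρ) : ‖π x‖ ≤ ‖x‖ := le_norm p x
  have hc : Continuous π := AddMonoidHomClass.continuous_of_bound π 1 (by simpa using hle)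
  have hcoe (x : PreTorus ρ) : extensionHom (π : PreTorus ρ →+* B) hc x = π x :=
    extensionHom_coe _ hc x
  have hcont : Continuous (extensionHom (π : PreTorus ρ →+* B) hc) := continuous_extension
  refine ⟨{ extensionHom (π : PreTorus ρ →+* B) hc with
    commutes' := fun c => ?_
    map_star' := fun x => ?_ }, fun j => ?_⟩
  · change extensionHom (π : PreTorus ρ →+* B) hc (algebraMap ℂ (QuantumTorus ρ) c) = _
    rw [Algebra.algebraMap_eq_smul_one, ← coe_one, ← coe_smul, hcoe, map_smul, map_one,
      Algebra.algebraMap_eq_smul_one]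
  · change extensionHom (π : PreTorus ρ →+* B) hc (star x) =
      star (extensionHom (π : PreTorus ρ →+* B) hc x)
    induction x using UniformSpace.Completion.induction_on with
    | hp => exact isClosed_eq (hcont.comp continuous_star') (continuous_star.comp hcont)
    | ih x => rw [star_coe, hcoe, hcoe, map_star]
  · exact (hcoe _).trans (hπ j)

/-- The universal property of the quantum torus: uniqueness. -/
theorem starAlgHom_ext {B : Type*} [CStarAlgebra B] {f g : QuantumTorus ρ →⋆ₐ[ℂ] B}
    (h : ∀ j, f (gen j) = g (gen j)) : f = g := by
  -- Agreement on generators passes to words, inverse letters being adjoints; linearity and density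
  -- then give the rest.
  have hw (w : FreeGroup (Fin 2)) :
      f ((single w 1 : PreTorus ρ) : QuantumTorus ρ) = g (single w 1 : PreTorus ρ) := by
    induction w using FreeGroup.induction_on with
    | C1 =>
      have : ((single 1 1 : PreTorus ρ) : QuantumTorus ρ) = 1 := rfl
      rw [this, map_one, map_one]
    | of j => exact h j
    | inv_of j _ =>
      have : ((single (FreeGroup.of j)⁻¹ 1 : PreTorus ρ) : QuantumTorus ρ) = star (gen j) := by
        rw [← coe_gen, star_coe, PreTorus.gen, star_single, map_one]
      rw [this, map_star, map_star, h]
    | mul x y hx hy =>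
      have : ((single (x * y) 1 : PreTorus ρ) : QuantumTorus ρ) =
          (single x 1 : PreTorus ρ) * (single y 1 : PreTorus ρ) := by
        rw [← coe_mul, single_mul_single, one_mul]
      rw [this, map_mul, map_mul, hx, hy]
  ext1 x
  induction x using UniformSpace.Completion.induction_on with
  | hp => exact isClosed_eq (map_continuous f) (map_continuous g)
  | ih x =>
    induction x using PreTorus.induction with
    | h0 => rw [coe_zero, map_zero, map_zero]
    | hadd x y hx hy => rw [coe_add, map_add, map_add, hx, hy]
    | hs w c => rw [single_eq_smul, coe_smul, map_smul, map_smul, hw]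

end QuantumTorus

/-! ### Coefficients in the crossed product -/

namespace CrossedProductZ2

variable {A : Type*} [CStarAlgebra A] {α : A ≃⋆ₐ[ℂ] A} {hα : ∀ a, α (α a) = a}

section

attribute [local instance] CStarAlgebra.spectralOrder CStarAlgebra.spectralOrderedRing

/-- The coefficients are the first-row entries of the isometric regular representation. -/
theorem continuous_a₀ : Continuous (a₀ : CrossedProductZ2 α hα → A) :=
  ((continuous_apply (0 : Fin 2)).comp (continuous_apply (0 : Fin 2))).comp
    isometry_toMatrix.continuous

theorem continuous_a₁ : Continuous (a₁ : CrossedProductZ2 α hα → A) :=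
  ((continuous_apply (1 : Fin 2)).comp (continuous_apply (0 : Fin 2))).comp
    isometry_toMatrix.continuous

end

/-- The inclusion of the coefficient algebra in the crossed product. -/
def ofCoeff (α : A ≃⋆ₐ[ℂ] A) (hα : ∀ a, α (α a) = a) : A →⋆ₐ[ℂ] CrossedProductZ2 α hα where
  toFun a := ⟨a, 0⟩
  map_one' := rfl
  map_mul' a b := by ext <;> simp
  map_zero' := rfl
  map_add' a b := by ext <;> simp
  commutes' c := by ext <;> simp [Algebra.algebraMap_eq_smul_one]
  map_star' a := by ext <;> simp

@[simp] theorem ofCoeff_a₀ (a : A) : (ofCoeff α hα a).a₀ = a := rfl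
@[simp] theorem ofCoeff_a₁ (a : A) : (ofCoeff α hα a).a₁ = 0 := rfl

variable (α hα) in
/-- The self-adjoint unitary implementing the action. -/
def delta : CrossedProductZ2 α hα := ⟨0, 1⟩

@[simp] theorem delta_a₀ : (delta α hα).a₀ = 0 := rfl
@[simp] theorem delta_a₁ : (delta α hα).a₁ = 1 := rfl

end CrossedProductZ2

/-! ### Anticommuting unitaries among the symmetric functions -/

namespace symmetricFunctions

open CrossedProductZ2 ContinuousMap

/-- The condition at each `w` is closed, since `dualAction` is a `⋆`-homomorphism of C⋆-algebras and
so continuous. Closedness provides the C⋆-structure. -/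
theorem isClosed : IsClosed (symmetricFunctions : Set C(Circle, CircleCrossedProduct)) := by
  have h : (symmetricFunctions : Set C(Circle, CircleCrossedProduct)) =
      ⋂ w, {h | dualAction (h (-w)) = h w} := by
    ext h
    simp only [Set.mem_iInter]
    rfl
  rw [h]
  exact isClosed_iInter fun w => isClosed_eq
    ((map_continuous dualAction).comp (continuous_eval_const _)) (continuous_eval_const _)

noncomputable instance : CStarAlgebra symmetricFunctions :=
  StarSubalgebra.cstarAlgebra _ (h_closed := isClosed)

theorem a₀_neg (h : symmetricFunctions) (w : Circle) : (h.1 (-w)).a₀ = (h.1 w).a₀ := by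
  rw [← show dualAction (h.1 (-w)) = h.1 w from h.2 w]
  rfl

theorem a₁_neg (h : symmetricFunctions) (w : Circle) : (h.1 (-w)).a₁ = -(h.1 w).a₁ := by
  rw [← show dualAction (h.1 (-w)) = h.1 w from h.2 w]
  exact (neg_neg _).symm

theorem antipodal_apply (f : C(Circle, ℂ)) (z : Circle) : antipodal f z = f (-z) := rfl

/-- The inclusion `Circle → ℂ`, as an element of the crossed product. -/
noncomputable def circleCoe : CircleCrossedProduct := ofCoeff _ _ ⟨fun z => z, by fun_prop⟩

theorem circleCoe_a₀ (z : Circle) : circleCoe.a₀ z = z := rfl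
theorem circleCoe_a₁ : circleCoe.a₁ = 0 := rfl

/-- The constant function with value `z ∈ C(S¹)`. -/
noncomputable def coordinate : symmetricFunctions :=
  ⟨.const _ circleCoe, fun w => by ext <;> simp [dualAction, circleCoe_a₁]⟩

/-- The function `w ↦ w δ`. -/
noncomputable def rotatedDelta : symmetricFunctions :=
  -- The sign of `-w` cancels the sign that the dual action puts on `δ`.
  ⟨⟨fun w => (w : ℂ) • delta _ _, by fun_prop⟩, fun w => by ext <;> simp [dualAction]⟩

theorem coordinate_apply (w : Circle) : coordinate.1 w = circleCoe := rfl

theorem rotatedDelta_apply (w : Circle) :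
    rotatedDelta.1 w = (w : ℂ) • delta antipodal antipodal_antipodal := rfl

theorem coordinate_mem_unitary : coordinate ∈ unitary symmetricFunctions := by
  constructor <;> ext w z <;>
    simp [coordinate_apply, circleCoe_a₀, circleCoe_a₁, ← Circle.coe_inv_eq_conj]

theorem rotatedDelta_mem_unitary : rotatedDelta ∈ unitary symmetricFunctions := by
  constructor <;> ext w z <;>
    simp [rotatedDelta_apply, ← Circle.coe_inv_eq_conj]

/-- Moving `δ` past `z` applies the antipodal action, which turns `z` into `-z`. -/
theorem rotatedDelta_mul_coordinate :
    rotatedDelta * coordinate = -(coordinate * rotatedDelta) := by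
  ext w z <;> simp [coordinate_apply, rotatedDelta_apply, antipodal_apply, circleCoe_a₀, circleCoe_a₁]

end symmetricFunctions

/-! ### Descent along the squaring map -/

theorem Circle.sq_surjective : Function.Surjective fun w : Circle => w ^ 2 := by
  intro w
  obtain ⟨t, rfl⟩ := Circle.exp_surjective w
  refine ⟨Circle.exp (t / 2), ?_⟩
  simp only [← Circle.exp_nsmul]
  congr 1
  simp
  ring

/-- A continuous function on the torus that is even in the second variable is a continuous
function of the square of the second variable. -/
theorem ContinuousMap.exists_eq_comp_sq_snd (k : C(Circle × Circle, ℂ))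
    (hk : ∀ z w, k (z, -w) = k (z, w)) :
    ∃ F : C(Circle × Circle, ℂ), ∀ z w, F (z, w ^ 2) = k (z, w) := by
  let q : C(Circle × Circle, Circle × Circle) := ⟨fun p => (p.1, p.2 ^ 2), by fun_prop⟩
  have hs : Function.Surjective q := by
    rintro ⟨z, w⟩
    obtain ⟨t, rfl⟩ := Circle.sq_surjective w
    exact ⟨(z, t), rfl⟩
  -- A continuous surjection from a compact space to a Hausdorff one is a quotient map; the fibres
  -- of `q` are the pairs `(z, ±w)`, on which `k` is constant.
  have hq : Topology.IsQuotientMap q := (map_continuous q).isClosedMap.isQuotientMap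
    (map_continuous q) hs
  have hf : Function.FactorsThrough k q := by
    rintro ⟨z, w⟩ ⟨z', w'⟩ h
    obtain ⟨rfl, h⟩ := Prod.mk.inj h
    have h' : (w : ℂ) ^ 2 = (w' : ℂ) ^ 2 := congrArg Subtype.val h
    rcases sq_eq_sq_iff_eq_or_eq_neg.1 h' with h | h
    · rw [Circle.ext h]
    · rw [show w = -w' from Circle.ext h, hk]
  exact ⟨hq.lift k hf, fun z w => congrFun (congrArg DFunLike.coe (hq.lift_comp k hf)) (z, w)⟩

namespace ContinuousMap

/-- The automorphism `F ↦ F(-z, w)` of `C(𝕋²)`. -/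
noncomputable def negFst : C(Circle × Circle, ℂ) →⋆ₐ[ℂ] C(Circle × Circle, ℂ) :=
  compStarAlgHom' ℂ ℂ ⟨fun p => (-p.1, p.2), by fun_prop⟩

@[simp] theorem negFst_apply (F : C(Circle × Circle, ℂ)) (z w : Circle) :
    negFst F (z, w) = F (-z, w) := rfl

theorem negFst_torusFst : negFst torusFst = -torusFst := by
  ext p
  simp [negFst]

theorem negFst_torusSnd : negFst torusSnd = torusSnd := rfl

end ContinuousMap

/-! ### Normal form and universal property of the symmetric functions -/

namespace symmetricFunctions

open CrossedProductZ2 ContinuousMap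

/-- The embedding of `C(𝕋²)` in the symmetric functions, `F ↦ (w ↦ F(·, w²))`. -/
noncomputable def ofTorus : C(Circle × Circle, ℂ) →⋆ₐ[ℂ] symmetricFunctions where
  -- The arguments are swapped because currying fixes the first one, which must be `w`.
  toFun F := ⟨⟨fun w => ofCoeff _ _
    ((F.comp ⟨fun p => (p.2, p.1 ^ 2), by fun_prop⟩ : C(Circle × Circle, ℂ)).curry w),
      (map_continuous (ofCoeff antipodal antipodal_antipodal)).comp (map_continuous _)⟩,
    fun w => by ext <;> simp [dualAction]⟩
  map_one' := rfl
  map_mul' F G := by ext <;> simp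
  map_zero' := rfl
  map_add' F G := by ext <;> simp
  commutes' c := by ext <;> simp [Algebra.algebraMap_eq_smul_one]
  map_star' F := by ext <;> simp

@[simp] theorem ofTorus_a₀ (F : C(Circle × Circle, ℂ)) (z w : Circle) :
    ((ofTorus F).1 w).a₀ z = F (z, w ^ 2) := rfl

@[simp] theorem ofTorus_a₁ (F : C(Circle × Circle, ℂ)) (w : Circle) :
    ((ofTorus F).1 w).a₁ = 0 := rfl

theorem ofTorus_torusFst : ofTorus torusFst = coordinate := by
  ext w z <;> simp [coordinate_apply, circleCoe_a₀, circleCoe_a₁]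

/-- Scalars are central and `δ² = 1`, so `(w δ)² = w²`. -/
theorem ofTorus_torusSnd : ofTorus torusSnd = rotatedDelta ^ 2 := by
  ext w z <;> simp [rotatedDelta_apply, sq]

theorem rotatedDelta_mul_ofTorus (F : C(Circle × Circle, ℂ)) :
    rotatedDelta * ofTorus F = ofTorus (negFst F) * rotatedDelta := by
  ext w z <;> simp [rotatedDelta_apply, antipodal_apply, mul_comm]

/-- The coefficients of `1` and `δ` at `w` are `F(·, w²)` and `w G(·, w²)`; `w` is invertible and
squaring is onto. -/
theorem ofTorus_add_mul_injective {F G F' G' : C(Circle × Circle, ℂ)}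
    (h : ofTorus F + ofTorus G * rotatedDelta = ofTorus F' + ofTorus G' * rotatedDelta) :
    F = F' ∧ G = G' := by
  constructor <;> ext ⟨z, w⟩ <;> obtain ⟨w, rfl⟩ := Circle.sq_surjective w
  · simpa [rotatedDelta_apply] using congrArg (fun k : symmetricFunctions => (k.1 w).a₀ z) h
  · simpa [rotatedDelta_apply] using congrArg (fun k : symmetricFunctions => (k.1 w).a₁ z) h

/-- Every symmetric function has the form `F(z, w²) + w G(z, w²) δ`. -/
theorem exists_eq_ofTorus_add_mul (h : symmetricFunctions) :
    ∃ F G : C(Circle × Circle, ℂ), h = ofTorus F + ofTorus G * rotatedDelta := by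
  have hc₀ : Continuous fun p : Circle × Circle => (h.1 p.2).a₀ p.1 :=
    continuous_eval.comp (((continuous_a₀.comp (map_continuous h.1)).comp continuous_snd).prodMk
      continuous_fst)
  have hc₁ : Continuous fun p : Circle × Circle => (h.1 p.2).a₁ p.1 :=
    continuous_eval.comp (((continuous_a₁.comp (map_continuous h.1)).comp continuous_snd).prodMk
      continuous_fst)
  obtain ⟨F, hF⟩ := exists_eq_comp_sq_snd ⟨_, hc₀⟩ fun z w => by simp [a₀_neg]
  -- The factor `w⁻¹ = star w` makes the odd coefficient even, and is undone by the `w` in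
  -- `rotatedDelta`.
  obtain ⟨G, hG⟩ := exists_eq_comp_sq_snd (star torusSnd * ⟨_, hc₁⟩) fun z w => by simp [a₁_neg]
  refine ⟨F, G, ?_⟩
  ext w z
  · simp [rotatedDelta_apply, hF]
  · simp [rotatedDelta_apply, hG, ← Circle.coe_inv_eq_conj]

/-- A `⋆`-homomorphism on the symmetric functions is determined by its values on the two
generators. -/
theorem starAlgHom_ext {A : Type*} [CStarAlgebra A] {f g : symmetricFunctions →⋆ₐ[ℂ] A}
    (h₁ : f coordinate = g coordinate) (h₂ : f rotatedDelta = g rotatedDelta) : f = g := by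
  have h : f.comp ofTorus = g.comp ofTorus := by
    apply starAlgHom_torus_ext
    · simpa [ofTorus_torusFst] using h₁
    · simp [ofTorus_torusSnd, h₂]
  ext1 x
  obtain ⟨F, G, rfl⟩ := exists_eq_ofTorus_add_mul x
  have h' (F) : f (ofTorus F) = g (ofTorus F) := DFunLike.congr_fun h F
  simp only [map_add, map_mul, h', h₂]

/-- Two anticommuting unitaries define a `⋆`-homomorphism on the symmetric functions. -/
theorem exists_lift {A : Type*} [CStarAlgebra A] (u v : unitary A)
    (huv : (v * u : A) = -(u * v : A)) :
    ∃ Ψ : symmetricFunctions →⋆ₐ[ℂ] A, Ψ coordinate = u ∧ Ψ rotatedDelta = v := by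
  have hcomm : Commute u (v ^ 2) := by
    apply Subtype.ext
    change (u * v ^ 2 : A) = v ^ 2 * u
    rw [sq, mul_assoc, huv, mul_neg, ← mul_assoc, ← mul_assoc, huv, neg_mul, neg_neg]
  obtain ⟨Φ, hu, hv⟩ := CStarAlgebra.exists_torus_starAlgHom u (v ^ 2) hcomm
  have hv : Φ torusSnd = v * v := by simpa [sq] using hv
  have hvv : star (v : A) * v = 1 := Unitary.coe_star_mul_self v
  -- It suffices to compare coordinates: `v u v⋆ = -u`, while `v` commutes with `v²`.
  have hconj : ((Unitary.conjStarAlgAut ℂ A v : A →⋆ₐ[ℂ] A).comp Φ) = Φ.comp negFst := by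
    apply starAlgHom_torus_ext
    · simp [hu, negFst_torusFst, huv, mul_assoc]
    · simp [hv, negFst_torusSnd, mul_assoc]
  have hcov (F) : (v * Φ F : A) = Φ (negFst F) * v := by
    have h : v * Φ F * star (v : A) = Φ (negFst F) := DFunLike.congr_fun hconj F
    rw [← h, mul_assoc, hvv, mul_one]
  choose F G hFG using exists_eq_ofTorus_add_mul
  -- By uniqueness of the normal form, the chosen `F h`, `G h` may be replaced by any decomposition;
  -- each axiom below reduces to exhibiting one.
  have huniq {h : symmetricFunctions} {F' G' : C(Circle × Circle, ℂ)}
      (hh : h = ofTorus F' + ofTorus G' * rotatedDelta) :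
      Φ (F h) + Φ (G h) * v = Φ F' + Φ G' * v := by
    obtain ⟨h₁, h₂⟩ := ofTorus_add_mul_injective ((hFG h).symm.trans hh)
    rw [h₁, h₂]
  refine ⟨{ toFun := fun h => Φ (F h) + Φ (G h) * v
            map_one' := ?_, map_mul' := fun h k => ?_, map_zero' := ?_, map_add' := fun h k => ?_
            commutes' := fun c => ?_, map_star' := fun h => ?_ }, ?_, ?_⟩
  · rw [huniq (F' := 1) (G' := 0) (by simp)]
    simp
  -- Moving `V` to the right applies `negFst`, and `V²` contributes the factor `torusSnd`.
  · have h₁ : h * k = ofTorus (F h * F k + G h * negFst (G k) * torusSnd) +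
        ofTorus (F h * G k + G h * negFst (F k)) * rotatedDelta := by
      conv_lhs => rw [hFG h, hFG k]
      simp only [map_add, map_mul, ofTorus_torusSnd, mul_add, add_mul, mul_assoc]
      rw [← mul_assoc rotatedDelta (ofTorus (G k)), rotatedDelta_mul_ofTorus,
        rotatedDelta_mul_ofTorus]
      simp only [sq, mul_assoc]
      abel
    rw [huniq h₁]
    simp only [map_add, map_mul, hv, mul_add, add_mul, mul_assoc]
    rw [← mul_assoc (v : A) (Φ (G k)), hcov, hcov]
    simp only [mul_assoc]
    abel
  · rw [huniq (F' := 0) (G' := 0) (by simp)]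
    simp
  · rw [huniq (F' := F h + F k) (G' := G h + G k)
      (by conv_lhs => rw [hFG h, hFG k]
          simp only [map_add, add_mul]
          abel)]
    simp only [map_add, add_mul]
    abel
  · rw [huniq (F' := algebraMap ℂ _ c) (G' := 0) (by simp [AlgHomClass.commutes])]
    simp [AlgHomClass.commutes]
  -- Normal form of the adjoint: `V⋆ = (V²)⋆ V` as `V` is unitary, and likewise for `v`.
  · have hstar : star rotatedDelta = ofTorus (star torusSnd) * rotatedDelta := by
      rw [map_star, ofTorus_torusSnd, sq, star_mul, mul_assoc, rotatedDelta_mem_unitary.1, mul_one]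
    have hstar' : (star v : A) = Φ (star torusSnd) * v := by
      rw [map_star, hv, star_mul, mul_assoc, hvv, mul_one]
    have h₁ : star h = ofTorus (star (F h)) +
        ofTorus (star torusSnd * negFst (star (G h))) * rotatedDelta := by
      conv_lhs => rw [hFG h]
      rw [star_add, star_mul, hstar, ← map_star, ← map_star, mul_assoc, rotatedDelta_mul_ofTorus,
        map_mul, mul_assoc]
    rw [huniq h₁, star_add, star_mul, hstar', ← map_star, ← map_star, mul_assoc, hcov, map_mul,
      mul_assoc]
  · change Φ _ + Φ _ * _ = _
    rw [huniq (F' := torusFst) (G' := 0) (by simp [ofTorus_torusFst])]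
    simp [hu]
  · change Φ _ + Φ _ * _ = _
    rw [huniq (F' := 0) (G' := 1) (by simp)]
    simp

end symmetricFunctions

/-! ### The isomorphism -/

theorem mainTheorem4 :
    Nonempty (QuantumTorus (-1) ≃⋆ₐ[ℂ] symmetricFunctions) := by
  obtain ⟨π, hπ⟩ := QuantumTorus.exists_lift (ρ := -1)
    ![⟨_, symmetricFunctions.coordinate_mem_unitary⟩,
      ⟨_, symmetricFunctions.rotatedDelta_mem_unitary⟩]
    (by simpa using symmetricFunctions.rotatedDelta_mul_coordinate)
  obtain ⟨Ψ, hΨ₀, hΨ₁⟩ := symmetricFunctions.exists_lift (A := QuantumTorus (-1))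
    ⟨_, QuantumTorus.gen_mem_unitary 0⟩ ⟨_, QuantumTorus.gen_mem_unitary 1⟩
    (by simpa using QuantumTorus.gen_mul_gen (ρ := -1))
  have hπ₀ : π (QuantumTorus.gen 0) = symmetricFunctions.coordinate := hπ 0
  have hπ₁ : π (QuantumTorus.gen 1) = symmetricFunctions.rotatedDelta := hπ 1
  -- Both composites fix the generators, so each is the identity by uniqueness.
  have h₁ : Ψ.comp π = StarAlgHom.id ℂ _ := QuantumTorus.starAlgHom_ext fun j => by
    fin_cases j
    · simpa [hπ₀] using hΨ₀
    · simpa [hπ₁] using hΨ₁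
  have h₂ : π.comp Ψ = StarAlgHom.id ℂ _ := symmetricFunctions.starAlgHom_ext
    (by simpa [hΨ₀] using hπ₀) (by simpa [hΨ₁] using hπ₁)
  exact ⟨StarAlgEquiv.ofStarAlgHom π Ψ h₁ h₂⟩
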